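/- For each index $k$ (in $\mathbb{N}$ with $k\to\infty$, or more generally in an index set equipped with a filter along which all limits below are taken), let $n=n_k$ and $T=T_k$ be positive integers, let $\Sigma=\Sigma_k$ be a real symmetric positive semidefinite $n\times n$ matrix with $\operatorname{Tr}\Sigma>0$, and let $X(1),\dots,X(T)$ be independent centered Gaussian random vectors in $\mathbb{R}^n$ with covariance matrix $\Sigma$, defined on a probability space that may depend on $k$. Let $\mathbf{X}$ be the $n\times T$ matrix with columns $X(1),\dots,X(T)$, let $\mathbf{E}=\frac1T\mathbf{X}\mathbf{X}'$ be the empirical covariance matrix, and put $q=n/T$ and, for $z\in\mathbb{C}\setminus\mathbb{R}$, $$\mathbf{G}(z)=(z-\mathbf{E})^{-1},\qquad G(z)=\frac1T\operatorname{Tr}\mathbf{G}(z),\qquad L(z)=\frac1T\operatorname{Tr}\big(\mathbf{G}(z)\Sigma\big).$$ Suppose that $n\to\infty$ and $T\to\infty$ in such a way that $q$, the operator norm $\|\Sigma\|$ (with respect to the Euclidean norm) and $T/\operatorname{Tr}\Sigma$ stay bounded. Then for every fixed $z\in\mathbb{C}\setminus\mathbb{R}$, the matrix $z-\mathbf{E}$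 is invertible, $1-q+zG(z)\neq0$, and $$L(z)=1-\frac{1}{1-q+zG(z)}+o(1),$$ where $o(1)$ denotes a random variable that tends to zero in probability, i.e. for every $\varepsilon>0$, $$\mathbb{P}\left(\left|L(z)-1+\frac{1}{1-q+zG(z)}\right|\ge\varepsilon\right)\longrightarrow 0 .$$ -/

import Mathlib

open MeasureTheory ProbabilityTheory Filter Topology

noncomputable section

namespace LedoitPeche

/-- The `n × T` real matrix whose columns are the vectors `x 0, …, x (T - 1)` of `ℝⁿ`. -/
def dataMatrix {n T : ℕ} (x : Fin T → EuclideanSpace ℝ (Fin n)) : Matrix (Fin n) (Fin T) ℝ :=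
  Matrix.of fun i t => x t i

/-- The empirical covariance matrix `E = (1 / T) X Xᵀ` of the sample `x`. -/
def empCov {n T : ℕ} (x : Fin T → EuclideanSpace ℝ (Fin n)) : Matrix (Fin n) (Fin n) ℝ :=
  (1 / (T : ℝ)) • (dataMatrix x * (dataMatrix x).transpose)

/-- The complex matrix `z - E`, where `E` is the empirical covariance matrix of the sample `x`. -/
def shifted {n T : ℕ} (x : Fin T → EuclideanSpace ℝ (Fin n)) (z : ℂ) :
    Matrix (Fin n) (Fin n) ℂ :=
  z • (1 : Matrix (Fin n) (Fin n) ℂ) - (empCov x).map (fun r : ℝ => (r : ℂ))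

/-- The resolvent matrix `(z - E)⁻¹` of the empirical covariance matrix `E`. -/
def resolventMatrix {n T : ℕ} (x : Fin T → EuclideanSpace ℝ (Fin n)) (z : ℂ) :
    Matrix (Fin n) (Fin n) ℂ :=
  (shifted x z)⁻¹

/-- `G(z) = (1 / T) Tr (z - E)⁻¹`. -/
def G {n T : ℕ} (x : Fin T → EuclideanSpace ℝ (Fin n)) (z : ℂ) : ℂ :=
  (1 / (T : ℂ)) * (resolventMatrix x z).trace

/-- `L(z) = (1 / T) Tr ((z - E)⁻¹ Σ)`, where `S` stands for the matrix `Σ`. -/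
def L {n T : ℕ} (S : Matrix (Fin n) (Fin n) ℝ) (x : Fin T → EuclideanSpace ℝ (Fin n)) (z : ℂ) :
    ℂ :=
  (1 / (T : ℂ)) * (resolventMatrix x z * S.map (fun r : ℝ => (r : ℂ))).trace

/-- The denominator `1 - q + z G(z)`, with `q = n / T`. -/
def denom {n T : ℕ} (x : Fin T → EuclideanSpace ℝ (Fin n)) (z : ℂ) : ℂ :=
  1 - (n : ℂ) / (T : ℂ) + z * G x z

/-- The operator norm of a real square matrix with respect to the Euclidean norm. -/
def opNorm {n : ℕ} (S : Matrix (Fin n) (Fin n) ℝ) : ℝ :=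
  ‖Matrix.toEuclideanCLM (𝕜 := ℝ) S‖

/-- Complex random variables `Y k`, each on its own probability space `(Ω k, P k)`, tend to zero
in probability along the filter `l`. -/
def TendsToZeroInProbability {ι : Type*} (l : Filter ι) {Ω : ι → Type*}
    [∀ k, MeasurableSpace (Ω k)] (P : ∀ k, Measure (Ω k)) (Y : ∀ k, Ω k → ℂ) : Prop :=
  ∀ ε : ℝ, 0 < ε → Tendsto (fun k => P k {ω | ε ≤ ‖Y k ω‖}) l (𝓝 0)

end LedoitPeche

end

namespace LedoitPeche

open scoped Matrix.Norms.L2Operator ComplexOrder ENNReal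
open Matrix WithLp

/-! ### Resolvents of positive semidefinite matrices -/

section Deterministic

variable {m : Type*} [Fintype m]

/-! The proof removes one sample vector at a time. Write `E = E_t + x_t x_tᵀ / T`, let `H_t` be the
resolvent of `E_t`, and put `a_t = x_tᵀ H_t x_t / T`. Taking the trace of `(z - E)(z - E)⁻¹ = 1` and
applying Sherman–Morrison to each `x_t` gives the exact identity `1 - q + zG = (1/T) ∑ (1 - a_t)⁻¹`
(`denom_eq`).

Each `a_t` is close to `L`. Since `x_t` is independent of `H_t`, the variance of a Gaussian
quadratic form puts `a_t` within `O(T^(-1/2))` of `Tr(H_t Σ) / T` in mean square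
(`lintegral_looDeviation_le`). Restoring `x_t` changes `Tr(H_t Σ)` by at most `‖Σ‖ / |Im z|`,
whatever the size of `x_t` (`norm_trace_resolvent_mul_sub_le`).

Stability comes from a sign: for `u = a_t` or `u = L`, `Im(zu)` never has the sign of `Im z`. Hence
`|1 - u| ≥ |Im z| / |z|`, so `u ↦ (1 - u)⁻¹` is Lipschitz on these values and `1 - q + zG ≈ (1 -
L)⁻¹`. As `|1 - L|` is bounded, this can be solved for `L` (`norm_sub_one_sub_one_div_le`). The same
sign gives `1 - q + zG ≠ 0`. -/

lemma star_dotProduct_self_eq_norm_sq (w : m → ℂ) :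
    star w ⬝ᵥ w = ((‖toLp 2 w‖ ^ 2 : ℝ) : ℂ) := by
  rw [EuclideanSpace.norm_sq_eq, dotProduct, Complex.ofReal_sum]
  refine Finset.sum_congr rfl fun i _ => ?_
  simp [Complex.conj_mul']

lemma norm_star_eq (w : m → ℂ) : ‖toLp 2 (star w)‖ = ‖toLp 2 w‖ := by
  simp [EuclideanSpace.norm_eq]

lemma norm_dotProduct_le (v w : m → ℂ) : ‖v ⬝ᵥ w‖ ≤ ‖toLp 2 v‖ * ‖toLp 2 w‖ := by
  have h := norm_inner_le_norm (𝕜 := ℂ) (toLp 2 (star v)) (toLp 2 w)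
  rw [EuclideanSpace.inner_toLp_toLp, star_star, dotProduct_comm, norm_star_eq] at h
  exact h

variable [DecidableEq m]

/-- Expand `w* (z - A)* w`, with `r = w* A w`. No inverse appears, so the identity also serves to
prove that `z - A` is injective. Its imaginary part, alone or after multiplication by `z`, yields
every resolvent bound below. -/
lemma star_dotProduct_of_mulVec_eq {A : Matrix m m ℂ} (hA : A.PosSemidef) {z : ℂ} {v w : m → ℂ}
    (h : (z • (1 : Matrix m m ℂ) - A) *ᵥ w = v) :
    ∃ r : ℝ, 0 ≤ r ∧
      star v ⬝ᵥ w = (starRingEnd ℂ) z * ((‖toLp 2 w‖ ^ 2 : ℝ) : ℂ) - (r : ℂ) := by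
  have h0 : 0 ≤ star w ⬝ᵥ (A *ᵥ w) := hA.dotProduct_mulVec_nonneg w
  obtain ⟨h1, h2⟩ := Complex.le_def.1 h0
  refine ⟨(star w ⬝ᵥ (A *ᵥ w)).re, by simpa using h1, ?_⟩
  have h3 : (((star w ⬝ᵥ (A *ᵥ w)).re : ℝ) : ℂ) = star w ⬝ᵥ (A *ᵥ w) :=
    Complex.ext (by simp) (by simpa using h2)
  rw [h3, ← star_dotProduct_self_eq_norm_sq, ← h, star_mulVec, conjTranspose_sub,
    conjTranspose_smul, conjTranspose_one, hA.isHermitian.eq, vecMul_sub, vecMul_smul, vecMul_one,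
    sub_dotProduct, smul_dotProduct, dotProduct_mulVec]
  simp

lemma isUnit_smul_one_sub {A : Matrix m m ℂ} (hA : A.PosSemidef) {z : ℂ} (hz : z.im ≠ 0) :
    IsUnit (z • (1 : Matrix m m ℂ) - A) := by
  rw [← mulVec_injective_iff_isUnit]
  refine (injective_iff_map_eq_zero (mulVecLin (z • (1 : Matrix m m ℂ) - A))).2 fun w hw => ?_
  obtain ⟨r, -, h⟩ := star_dotProduct_of_mulVec_eq hA (v := 0) (w := w) hw
  have h' := congrArg Complex.im h
  rw [Complex.sub_im, Complex.im_mul_ofReal] at h'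
  simpa [hz] using h'

lemma smul_one_sub_mul_inv {A : Matrix m m ℂ} (hA : A.PosSemidef) {z : ℂ} (hz : z.im ≠ 0) :
    (z • (1 : Matrix m m ℂ) - A) * (z • (1 : Matrix m m ℂ) - A)⁻¹ = 1 :=
  mul_nonsing_inv _ ((isUnit_iff_isUnit_det _).1 (isUnit_smul_one_sub hA hz))

lemma inv_mul_smul_one_sub {A : Matrix m m ℂ} (hA : A.PosSemidef) {z : ℂ} (hz : z.im ≠ 0) :
    (z • (1 : Matrix m m ℂ) - A)⁻¹ * (z • (1 : Matrix m m ℂ) - A) = 1 :=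
  nonsing_inv_mul _ ((isUnit_iff_isUnit_det _).1 (isUnit_smul_one_sub hA hz))

/-- The quadratic form of the resolvent of a positive semidefinite matrix. -/
lemma star_dotProduct_resolvent {A : Matrix m m ℂ} (hA : A.PosSemidef) {z : ℂ} (hz : z.im ≠ 0)
    (v : m → ℂ) :
    ∃ r : ℝ, 0 ≤ r ∧
      star v ⬝ᵥ ((z • (1 : Matrix m m ℂ) - A)⁻¹ *ᵥ v) = (starRingEnd ℂ) z *
        ((‖toLp 2 ((z • (1 : Matrix m m ℂ) - A)⁻¹ *ᵥ v)‖ ^ 2 : ℝ) : ℂ) - (r : ℂ) :=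
  star_dotProduct_of_mulVec_eq hA
    (by rw [mulVec_mulVec, smul_one_sub_mul_inv hA hz, one_mulVec])

lemma im_star_dotProduct_resolvent {A : Matrix m m ℂ} (hA : A.PosSemidef) {z : ℂ}
    (hz : z.im ≠ 0) (v : m → ℂ) :
    (star v ⬝ᵥ ((z • (1 : Matrix m m ℂ) - A)⁻¹ *ᵥ v)).im =
      -z.im * ‖toLp 2 ((z • (1 : Matrix m m ℂ) - A)⁻¹ *ᵥ v)‖ ^ 2 := by
  obtain ⟨r, -, h⟩ := star_dotProduct_resolvent hA hz v
  rw [h, Complex.sub_im, Complex.im_mul_ofReal]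
  simp

lemma im_mul_star_dotProduct_resolvent {A : Matrix m m ℂ} (hA : A.PosSemidef) {z : ℂ}
    (hz : z.im ≠ 0) (v : m → ℂ) :
    (z * (star v ⬝ᵥ ((z • (1 : Matrix m m ℂ) - A)⁻¹ *ᵥ v))).im * z.im ≤ 0 := by
  obtain ⟨r, hr, h⟩ := star_dotProduct_resolvent hA hz v
  rw [h, mul_sub, ← mul_assoc, Complex.mul_conj, ← Complex.ofReal_mul, Complex.sub_im,
    Complex.ofReal_im, Complex.im_mul_ofReal]
  nlinarith [mul_nonneg hr (sq_nonneg z.im)]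

lemma norm_resolvent_le {A : Matrix m m ℂ} (hA : A.PosSemidef) {z : ℂ} (hz : z.im ≠ 0) :
    ‖(z • (1 : Matrix m m ℂ) - A)⁻¹‖ ≤ |z.im|⁻¹ := by
  rw [l2_opNorm_def]
  refine ContinuousLinearMap.opNorm_le_bound _ (by positivity) fun v => ?_
  have h1 := im_star_dotProduct_resolvent hA hz (ofLp v)
  have h2 := (Complex.abs_im_le_norm _).trans (norm_dotProduct_le (star (ofLp v))
    ((z • (1 : Matrix m m ℂ) - A)⁻¹ *ᵥ (ofLp v)))
  rw [h1, norm_star_eq, abs_mul, abs_neg, abs_pow, abs_norm] at h2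
  change ‖toLp 2 ((z • (1 : Matrix m m ℂ) - A)⁻¹ *ᵥ (ofLp v))‖ ≤ _
  set y := ‖toLp 2 ((z • (1 : Matrix m m ℂ) - A)⁻¹ *ᵥ (ofLp v))‖ with hy
  have hy0 : 0 ≤ y := norm_nonneg _
  have hz' : 0 < |z.im| := abs_pos.2 hz
  -- The imaginary part of the form together with Cauchy–Schwarz gives `|Im z| y² ≤ ‖v‖ y`; one
  -- factor `y` is cancelled.
  rw [inv_mul_eq_div, le_div_iff₀ hz']
  rcases hy0.eq_or_lt with h0 | h0
  · rw [← h0]; simp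
  · refine le_of_mul_le_mul_right ?_ h0
    calc y * |z.im| * y = |z.im| * y ^ 2 := by ring
      _ ≤ ‖v‖ * y := h2

/-- The trace is a sum of quadratic forms over the columns of `Bᴴ`. With `B` the square root of `Σ`
it gives the sign property of `L`. -/
lemma im_mul_trace_resolvent_mul {A : Matrix m m ℂ} (hA : A.PosSemidef) (B : Matrix m m ℂ)
    {z : ℂ} (hz : z.im ≠ 0) :
    (z * ((z • (1 : Matrix m m ℂ) - A)⁻¹ * (Bᴴ * B)).trace).im * z.im ≤ 0 := by
  have h : ((z • (1 : Matrix m m ℂ) - A)⁻¹ * (Bᴴ * B)).trace =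
      ∑ i, star (Bᴴ.col i) ⬝ᵥ ((z • (1 : Matrix m m ℂ) - A)⁻¹ *ᵥ Bᴴ.col i) := by
    rw [← Matrix.mul_assoc, trace_mul_comm, trace]
    refine Finset.sum_congr rfl fun i _ => ?_
    rw [diag_apply, Matrix.mul_apply_eq_vecMul, vecMul_eq_sum]
    simp [dotProduct, mulVec, Matrix.mul_apply]
  rw [h, Finset.mul_sum, Complex.im_sum, Finset.sum_mul]
  exact Finset.sum_nonpos fun i _ => im_mul_star_dotProduct_resolvent hA hz _

/-- In `Im(z(1 - u)) = Im z - Im(zu)` the two contributions do not cancel. -/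
lemma abs_im_le_norm_mul_norm_one_sub {z u : ℂ} (h : (z * u).im * z.im ≤ 0) :
    |z.im| ≤ ‖z‖ * ‖1 - u‖ := by
  rw [← norm_mul]
  refine le_trans ?_ (Complex.abs_im_le_norm _)
  rw [mul_sub, mul_one, Complex.sub_im]
  refine sq_le_sq.1 ?_
  nlinarith [sq_nonneg ((z * u).im)]

lemma norm_apply_le_l2_opNorm (M : Matrix m m ℂ) (i j : m) : ‖M i j‖ ≤ ‖M‖ := by
  have h := l2_opNorm_mulVec M (EuclideanSpace.single j 1)
  have h2 := PiLp.norm_apply_le (toLp 2 (M *ᵥ ofLp (EuclideanSpace.single j (1 : ℂ)))) i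
  simp only [PiLp.ofLp_single, mulVec_single_one, PiLp.norm_single,
    norm_one, mul_one] at h h2
  exact h2.trans h

lemma norm_trace_le (M : Matrix m m ℂ) : ‖M.trace‖ ≤ Fintype.card m * ‖M‖ := by
  refine (norm_sum_le _ _).trans ?_
  refine (Finset.sum_le_sum fun i _ => norm_apply_le_l2_opNorm M i i).trans ?_
  simp

end Deterministic

/-! ### Rank-one perturbations of the resolvent -/

section RankOne

variable {m : Type*} [Fintype m]

lemma posSemidef_vecMulVec_of_star_eq {x : m → ℂ} (hx : star x = x) :
    (vecMulVec x x).PosSemidef := by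
  have := posSemidef_vecMulVec_self_star x
  rwa [hx] at this

lemma posSemidef_add_smul_vecMulVec {A : Matrix m m ℂ} (hA : A.PosSemidef) {x : m → ℂ}
    (hx : star x = x) {τ : ℝ} (hτ : 0 ≤ τ) :
    (A + (τ : ℂ) • vecMulVec x x).PosSemidef :=
  hA.add ((posSemidef_vecMulVec_of_star_eq hx).smul (by exact_mod_cast hτ))

variable [DecidableEq m]

lemma im_mul_dotProduct_resolvent {A : Matrix m m ℂ} (hA : A.PosSemidef) {x : m → ℂ}
    (hx : star x = x) {τ : ℝ} (hτ : 0 ≤ τ) {z : ℂ} (hz : z.im ≠ 0) :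
    (z * ((τ : ℂ) * (x ⬝ᵥ ((z • (1 : Matrix m m ℂ) - A)⁻¹ *ᵥ x)))).im * z.im ≤ 0 := by
  have h := im_mul_star_dotProduct_resolvent hA hz x
  rw [hx] at h
  rw [mul_left_comm, Complex.im_ofReal_mul, mul_assoc]
  exact mul_nonpos_of_nonneg_of_nonpos hτ h

lemma one_sub_ne_zero_of_im {z u : ℂ} (hz : z.im ≠ 0) (h : (z * u).im * z.im ≤ 0) :
    1 - u ≠ 0 := by
  intro h0
  have := abs_im_le_norm_mul_norm_one_sub h
  rw [h0, norm_zero, mul_zero] at this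
  exact hz (abs_nonpos_iff.1 this)

lemma resolvent_sub_resolvent {A : Matrix m m ℂ} (hA : A.PosSemidef) {x : m → ℂ}
    (hx : star x = x) {τ : ℝ} (hτ : 0 ≤ τ) {z : ℂ} (hz : z.im ≠ 0) :
    (z • (1 : Matrix m m ℂ) - (A + (τ : ℂ) • vecMulVec x x))⁻¹ -
        (z • (1 : Matrix m m ℂ) - A)⁻¹ =
      (τ : ℂ) • ((z • (1 : Matrix m m ℂ) - (A + (τ : ℂ) • vecMulVec x x))⁻¹ * vecMulVec x x *
        (z • (1 : Matrix m m ℂ) - A)⁻¹) := by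
  have h1 := inv_mul_smul_one_sub (posSemidef_add_smul_vecMulVec hA hx hτ) hz
  have h2 := smul_one_sub_mul_inv hA hz
  set M := z • (1 : Matrix m m ℂ) - A with hM
  set M' := z • (1 : Matrix m m ℂ) - (A + (τ : ℂ) • vecMulVec x x) with hM'
  have h3 : M - M' = (τ : ℂ) • vecMulVec x x := by rw [hM, hM']; abel
  calc M'⁻¹ - M⁻¹ = M'⁻¹ * (M * M⁻¹) - (M'⁻¹ * M') * M⁻¹ := by rw [h1, h2]; simp
    _ = M'⁻¹ * (M - M') * M⁻¹ := by noncomm_ring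
    _ = _ := by rw [h3]; simp

/-- The Sherman–Morrison formula, applied to the vector of the perturbation. -/
lemma resolvent_mulVec_rankOne {A : Matrix m m ℂ} (hA : A.PosSemidef) {x : m → ℂ}
    (hx : star x = x) {τ : ℝ} (hτ : 0 ≤ τ) {z : ℂ} (hz : z.im ≠ 0) :
    (1 - (τ : ℂ) * (x ⬝ᵥ ((z • (1 : Matrix m m ℂ) - A)⁻¹ *ᵥ x))) •
        ((z • (1 : Matrix m m ℂ) - (A + (τ : ℂ) • vecMulVec x x))⁻¹ *ᵥ x) =
      (z • (1 : Matrix m m ℂ) - A)⁻¹ *ᵥ x := by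
  have h := congrArg (fun M : Matrix m m ℂ => M *ᵥ x) (resolvent_sub_resolvent hA hx hτ hz)
  simp only [sub_mulVec, smul_mulVec, ← mulVec_mulVec, vecMulVec_mulVec, mulVec_smul,
    op_smul_eq_smul] at h
  rw [sub_smul, one_smul, mul_smul, ← h]
  abel

lemma rankOne_dotProduct_resolvent {A : Matrix m m ℂ} (hA : A.PosSemidef) {x : m → ℂ}
    (hx : star x = x) {τ : ℝ} (hτ : 0 ≤ τ) {z : ℂ} (hz : z.im ≠ 0) :
    1 + (τ : ℂ) *
        (x ⬝ᵥ ((z • (1 : Matrix m m ℂ) - (A + (τ : ℂ) • vecMulVec x x))⁻¹ *ᵥ x)) =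
      (1 - (τ : ℂ) * (x ⬝ᵥ ((z • (1 : Matrix m m ℂ) - A)⁻¹ *ᵥ x)))⁻¹ := by
  have hne := one_sub_ne_zero_of_im hz (im_mul_dotProduct_resolvent hA hx hτ hz)
  have h := congrArg (fun v => x ⬝ᵥ v) (resolvent_mulVec_rankOne hA hx hτ hz)
  simp only [dotProduct_smul, smul_eq_mul] at h
  refine eq_inv_of_mul_eq_one_left ?_
  linear_combination (τ : ℂ) * h

/-- The difference equals `τ (Hx)·S(Hx) / (1 - a)` with `a = τ x·Hx`. The numerator is at most `τ
‖S‖ ‖Hx‖²`, while `|1 - a| ≥ |Im a| = τ |Im z| ‖Hx‖²`, so the dependence on `x` and `τ` cancels. -/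
lemma norm_trace_resolvent_mul_sub_le {A : Matrix m m ℂ} (hA : A.PosSemidef) (hAt : Aᵀ = A)
    (S : Matrix m m ℂ) {x : m → ℂ}
    (hx : star x = x) {τ : ℝ} (hτ : 0 ≤ τ) {z : ℂ} (hz : z.im ≠ 0) :
    ‖((z • (1 : Matrix m m ℂ) - (A + (τ : ℂ) • vecMulVec x x))⁻¹ * S).trace -
      ((z • (1 : Matrix m m ℂ) - A)⁻¹ * S).trace‖ ≤ ‖S‖ / |z.im| := by
  have hne := one_sub_ne_zero_of_im hz (im_mul_dotProduct_resolvent hA hx hτ hz)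
  have him := im_star_dotProduct_resolvent hA hz x
  have h1 := resolvent_sub_resolvent hA hx hτ hz
  have h2 := resolvent_mulVec_rankOne hA hx hτ hz
  have hHt : ((z • (1 : Matrix m m ℂ) - A)⁻¹)ᵀ = (z • (1 : Matrix m m ℂ) - A)⁻¹ := by
    rw [transpose_nonsing_inv, transpose_sub, transpose_smul, transpose_one, hAt]
  set H := (z • (1 : Matrix m m ℂ) - A)⁻¹ with hH
  set K := (z • (1 : Matrix m m ℂ) - (A + (τ : ℂ) • vecMulVec x x))⁻¹ with hK
  set a := (τ : ℂ) * (x ⬝ᵥ (H *ᵥ x)) with ha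
  have h3 : (1 - a) * ((K * S).trace - (H * S).trace) =
      (τ : ℂ) * ((H *ᵥ x) ⬝ᵥ (S *ᵥ (H *ᵥ x))) := by
    rw [← trace_sub, ← sub_mul, h1, smul_mul, trace_smul, mul_vecMulVec, vecMulVec_mul,
      vecMulVec_mul, trace_vecMulVec, ← mulVec_transpose H, hHt, smul_eq_mul, mul_left_comm,
      ← smul_eq_mul (1 - a), ← smul_dotProduct, h2, dotProduct_comm,
      ← dotProduct_mulVec]
  have h4 : ‖(τ : ℂ) * ((H *ᵥ x) ⬝ᵥ (S *ᵥ (H *ᵥ x)))‖ ≤ τ * ‖S‖ * ‖toLp 2 (H *ᵥ x)‖ ^ 2 := by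
    rw [norm_mul, Complex.norm_real, Real.norm_of_nonneg hτ, mul_assoc]
    refine mul_le_mul_of_nonneg_left ((norm_dotProduct_le _ _).trans ?_) hτ
    have := l2_opNorm_mulVec S (toLp 2 (H *ᵥ x))
    calc _ ≤ ‖toLp 2 (H *ᵥ x)‖ * (‖S‖ * ‖toLp 2 (H *ᵥ x)‖) :=
          mul_le_mul_of_nonneg_left this (norm_nonneg _)
      _ = _ := by ring
  have h5 : τ * ‖toLp 2 (H *ᵥ x)‖ ^ 2 * |z.im| ≤ ‖1 - a‖ := by
    refine le_trans (le_of_eq ?_) (Complex.abs_im_le_norm _)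
    rw [hx] at him
    rw [ha, Complex.sub_im, Complex.one_im, Complex.im_ofReal_mul, him, zero_sub, abs_neg,
      abs_mul, abs_mul, abs_neg, abs_of_nonneg hτ, abs_pow, abs_norm]
    ring
  rw [← h3, norm_mul] at h4
  have hpos : 0 < ‖1 - a‖ := norm_pos_iff.2 hne
  have hz' : 0 < |z.im| := abs_pos.2 hz
  rw [le_div_iff₀ hz']
  refine le_of_mul_le_mul_left ?_ hpos
  nlinarith [norm_nonneg S, mul_le_mul_of_nonneg_left h5 (norm_nonneg S),
    mul_le_mul_of_nonneg_right h4 hz'.le]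

end RankOne

end LedoitPeche

namespace LedoitPeche

open scoped Matrix.Norms.L2Operator ComplexOrder ENNReal
open Matrix WithLp

/-! ### Operator norms under passage between real and complex matrices -/

section Complexification

variable {m : Type*} [Fintype m]

lemma norm_toLp_ofReal_comp (v : m → ℝ) :
    ‖toLp 2 (fun i => (v i : ℂ))‖ = ‖toLp 2 v‖ := by
  simp [EuclideanSpace.norm_eq]

lemma norm_toLp_re_sq_add_norm_toLp_im_sq (v : m → ℂ) :
    ‖toLp 2 (fun i => (v i).re)‖ ^ 2 + ‖toLp 2 (fun i => (v i).im)‖ ^ 2 = ‖toLp 2 v‖ ^ 2 := by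
  simp only [EuclideanSpace.norm_sq_eq, ← Finset.sum_add_distrib]
  refine Finset.sum_congr rfl fun i _ => ?_
  rw [Complex.sq_norm, Complex.normSq_apply]
  simp [pow_two]

lemma norm_toLp_re_le (v : m → ℂ) : ‖toLp 2 (fun i => (v i).re)‖ ≤ ‖toLp 2 v‖ := by
  refine abs_le_of_sq_le_sq' ?_ (norm_nonneg _) |>.2
  nlinarith [norm_toLp_re_sq_add_norm_toLp_im_sq v, sq_nonneg ‖toLp 2 (fun i => (v i).im)‖]

lemma norm_toLp_im_le (v : m → ℂ) : ‖toLp 2 (fun i => (v i).im)‖ ≤ ‖toLp 2 v‖ := by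
  refine abs_le_of_sq_le_sq' ?_ (norm_nonneg _) |>.2
  nlinarith [norm_toLp_re_sq_add_norm_toLp_im_sq v, sq_nonneg ‖toLp 2 (fun i => (v i).re)‖]

variable [DecidableEq m]

lemma l2_opNorm_le_of_mulVec {𝕜 : Type*} [RCLike 𝕜] {A : Matrix m m 𝕜} {C : ℝ} (hC : 0 ≤ C)
    (h : ∀ v : m → 𝕜, ‖toLp 2 (A *ᵥ v)‖ ≤ C * ‖toLp 2 v‖) : ‖A‖ ≤ C := by
  rw [l2_opNorm_def]
  exact ContinuousLinearMap.opNorm_le_bound _ hC fun v => h (v)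

lemma l2_opNorm_map_ofReal_le (S : Matrix m m ℝ) :
    ‖S.map (fun r : ℝ => (r : ℂ))‖ ≤ ‖S‖ := by
  refine l2_opNorm_le_of_mulVec (norm_nonneg _) fun v => ?_
  refine abs_le_of_sq_le_sq' ?_ (by positivity) |>.2
  have h1 := l2_opNorm_mulVec S (toLp 2 fun i => (v i).re)
  have h2 := l2_opNorm_mulVec S (toLp 2 fun i => (v i).im)
  rw [← norm_toLp_re_sq_add_norm_toLp_im_sq, mul_pow]
  rw [← norm_toLp_re_sq_add_norm_toLp_im_sq (v), mul_add, ← mul_pow, ← mul_pow]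
  have e1 : (fun i => ((S.map (fun r : ℝ => (r : ℂ)) *ᵥ v) i).re) =
      S *ᵥ (fun i => (v i).re) := by
    ext i; simp [mulVec, dotProduct]
  have e2 : (fun i => ((S.map (fun r : ℝ => (r : ℂ)) *ᵥ v) i).im) =
      S *ᵥ (fun i => (v i).im) := by
    ext i; simp [mulVec, dotProduct]
  rw [e1, e2]
  gcongr
  · exact h1
  · exact h2

lemma l2_opNorm_map_re_le (N : Matrix m m ℂ) : ‖N.map Complex.re‖ ≤ ‖N‖ := by
  refine l2_opNorm_le_of_mulVec (norm_nonneg _) fun v => ?_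
  have e : N.map Complex.re *ᵥ v =
      fun i => ((N *ᵥ (fun i => (v i : ℂ))) i).re := by
    ext i; simp [mulVec, dotProduct]
  rw [e, ← norm_toLp_ofReal_comp v]
  exact (norm_toLp_re_le (N *ᵥ fun i => (v i : ℂ))).trans (l2_opNorm_mulVec N (toLp 2 fun i => (v i : ℂ)))

lemma l2_opNorm_map_im_le (N : Matrix m m ℂ) : ‖N.map Complex.im‖ ≤ ‖N‖ := by
  refine l2_opNorm_le_of_mulVec (norm_nonneg _) fun v => ?_
  have e : N.map Complex.im *ᵥ v =
      fun i => ((N *ᵥ (fun i => (v i : ℂ))) i).im := by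
    ext i; simp [mulVec, dotProduct]
  rw [e, ← norm_toLp_ofReal_comp v]
  exact (norm_toLp_im_le (N *ᵥ fun i => (v i : ℂ))).trans (l2_opNorm_mulVec N (toLp 2 fun i => (v i : ℂ)))

end Complexification

/-! ### Variance of real Gaussian quadratic forms -/

section GaussianQuadraticForm

variable {m : Type*} [Fintype m] [DecidableEq m]

lemma memLp_sq_gaussianReal : MemLp (fun x : ℝ => x ^ 2) 2 (gaussianReal 0 1) := by
  rw [memLp_two_iff_integrable_sq (by fun_prop)]
  have := (memLp_id_gaussianReal (μ := 0) (v := 1) 4).integrable_norm_pow (p := 4) (by norm_num)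
  refine this.congr (ae_of_all _ fun x => ?_)
  simp only [id, Real.norm_eq_abs]
  rw [← pow_mul, Even.pow_abs (by decide)]

lemma integral_sq_gaussianReal : ∫ x, x ^ 2 ∂(gaussianReal 0 1) = 1 := by
  have h := variance_fun_id_gaussianReal (μ := 0) (v := 1)
  rw [variance_of_integral_eq_zero (by fun_prop) integral_id_gaussianReal] at h
  simpa using h

lemma abs_eigenvalues_le {R : Matrix m m ℝ} (hR : R.IsHermitian) (i : m) :
    |hR.eigenvalues i| ≤ ‖R‖ := by
  have h := l2_opNorm_mulVec R (hR.eigenvectorBasis i)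
  rw [hR.mulVec_eigenvectorBasis] at h
  simpa [norm_smul] using h

lemma dotProduct_mulVec_eigenvectorBasis {R : Matrix m m ℝ} (hR : R.IsHermitian) (x : m → ℝ) :
    ofLp (∑ i, x i • hR.eigenvectorBasis i) ⬝ᵥ (R *ᵥ ofLp (∑ i, x i • hR.eigenvectorBasis i)) =
      ∑ i, hR.eigenvalues i * x i ^ 2 := by
  have h : toLp 2 (R *ᵥ ofLp (∑ i, x i • hR.eigenvectorBasis i)) =
      ∑ i, (x i * hR.eigenvalues i) • hR.eigenvectorBasis i := by
    rw [ofLp_sum, mulVec_sum, toLp_sum]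
    refine Finset.sum_congr rfl fun i _ => ?_
    rw [ofLp_smul, mulVec_smul, hR.mulVec_eigenvectorBasis, mul_smul]
    rfl
  have h2 : ofLp (∑ i, x i • hR.eigenvectorBasis i) ⬝ᵥ
      (R *ᵥ ofLp (∑ i, x i • hR.eigenvectorBasis i)) =
      inner ℝ (toLp 2 (R *ᵥ ofLp (∑ i, x i • hR.eigenvectorBasis i)))
        (∑ i, x i • hR.eigenvectorBasis i) := by
    rw [EuclideanSpace.inner_eq_star_dotProduct]; rfl
  rw [h2, h, hR.eigenvectorBasis.orthonormal.inner_sum]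
  refine Finset.sum_congr rfl fun i _ => ?_
  simp; ring

/-- The variance of a real quadratic form in a standard Gaussian vector. -/
lemma lintegral_quadForm_sub_trace_le {R : Matrix m m ℝ} (hR : R.IsHermitian) :
    ∫⁻ x, ‖ofLp x ⬝ᵥ (R *ᵥ ofLp x) - R.trace‖ₑ ^ 2 ∂(stdGaussian (EuclideanSpace ℝ m)) ≤
      ENNReal.ofReal (Var[fun x => x ^ 2; gaussianReal 0 1] * Fintype.card m * ‖R‖ ^ 2) := by
  have hmeas : Measurable fun x : m → ℝ => ∑ i, x i • hR.eigenvectorBasis i := by fun_prop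
  -- By rotation invariance the coordinates in an eigenbasis of `R` are independent standard
  -- Gaussians, and the form becomes `∑ λ_i x_i²`.
  rw [stdGaussian_eq_map_pi_orthonormalBasis hR.eigenvectorBasis,
    lintegral_map (by unfold dotProduct mulVec dotProduct; fun_prop) hmeas]
  simp only [dotProduct_mulVec_eigenvectorBasis]
  have hL (i : m) : MemLp (fun x : ℝ => hR.eigenvalues i * x ^ 2) 2 (gaussianReal 0 1) :=
    memLp_sq_gaussianReal.const_mul _
  have hLpi (i : m) : MemLp (fun x : m → ℝ => hR.eigenvalues i * x i ^ 2) 2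
      (Measure.pi fun _ => gaussianReal 0 1) :=
    (hL i).comp_measurePreserving (measurePreserving_eval _ i)
  have hsum : (fun x : m → ℝ => ∑ i, hR.eigenvalues i * x i ^ 2) =
      ∑ i, fun x : m → ℝ => hR.eigenvalues i * x i ^ 2 := by
    ext x; simp
  have hmean : ∫ x : m → ℝ, ∑ i, hR.eigenvalues i * x i ^ 2
      ∂(Measure.pi fun _ => gaussianReal 0 1) = R.trace := by
    rw [integral_finsetSum _ fun i _ => (hLpi i).integrable (by norm_num),
      hR.trace_eq_sum_eigenvalues]
    refine Finset.sum_congr rfl fun i _ => ?_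
    rw [integral_const_mul]
    rw [integral_comp_eval (μ := fun _ : m => gaussianReal 0 1) (i := i)
      (f := fun x : ℝ => x ^ 2) (by fun_prop), integral_sq_gaussianReal, mul_one]
    rfl
  have hvar := variance_sum_pi hL
  rw [← hsum] at hvar
  have hmem : MemLp (fun x : m → ℝ => ∑ i, hR.eigenvalues i * x i ^ 2) 2
      (Measure.pi fun _ => gaussianReal 0 1) := memLp_finsetSum _ fun i _ => hLpi i
  have hev := hmem.ofReal_variance_eq
  rw [evariance, hmean, hvar] at hev
  rw [← hev]
  refine ENNReal.ofReal_le_ofReal ?_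
  simp only [variance_const_mul]
  calc ∑ i, hR.eigenvalues i ^ 2 * Var[fun x => x ^ 2; gaussianReal 0 1]
      ≤ ∑ _i : m, ‖R‖ ^ 2 * Var[fun x => x ^ 2; gaussianReal 0 1] := by
        refine Finset.sum_le_sum fun i _ => mul_le_mul_of_nonneg_right ?_ (variance_nonneg _ _)
        rw [← sq_abs]
        exact pow_le_pow_left₀ (abs_nonneg _) (abs_eigenvalues_le hR i) 2
    _ = _ := by simp; ring

end GaussianQuadraticForm

end LedoitPeche

namespace LedoitPeche

open scoped ENNReal ComplexOrder
open Matrix WithLp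

/-! ### Sample covariance matrices and their resolvents -/

section SampleCovariance

variable {m : Type*}

/-- A real vector, regarded as a complex vector. -/
def cvec (x : EuclideanSpace ℝ m) : m → ℂ := fun i => (x i : ℂ)

lemma star_cvec (x : EuclideanSpace ℝ m) : star (cvec x) = cvec x := by
  ext i; simp [cvec]

lemma continuous_cvec : Continuous (cvec : EuclideanSpace ℝ m → m → ℂ) := by
  unfold cvec; fun_prop

variable {κ : Type*} [Fintype κ]

/-- The sum of the rank-one matrices of a finite family of real vectors, scaled by `τ`. -/
def sampleCov (τ : ℝ) (y : κ → EuclideanSpace ℝ m) : Matrix m m ℂ :=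
  ∑ s, (τ : ℂ) • vecMulVec (cvec (y s)) (cvec (y s))

lemma continuous_sampleCov (τ : ℝ) :
    Continuous (sampleCov τ : (κ → EuclideanSpace ℝ m) → Matrix m m ℂ) := by
  refine continuous_matrix fun i j => ?_
  simp only [sampleCov, cvec, Matrix.sum_apply, Matrix.smul_apply, vecMulVec_apply]
  fun_prop

lemma transpose_sampleCov (τ : ℝ) (y : κ → EuclideanSpace ℝ m) :
    (sampleCov τ y)ᵀ = sampleCov τ y := by
  simp [sampleCov, transpose_sum, transpose_vecMulVec]

variable [Fintype m]

lemma posSemidef_sampleCov {τ : ℝ} (hτ : 0 ≤ τ) (y : κ → EuclideanSpace ℝ m) :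
    (sampleCov τ y).PosSemidef :=
  posSemidef_sum _ fun s _ =>
    (posSemidef_vecMulVec_of_star_eq (star_cvec (y s))).smul (by exact_mod_cast hτ)

variable [DecidableEq m]

/-- The resolvent of `sampleCov τ y` at `z`. -/
noncomputable def sampleResolvent (τ : ℝ) (y : κ → EuclideanSpace ℝ m) (z : ℂ) : Matrix m m ℂ :=
  (z • (1 : Matrix m m ℂ) - sampleCov τ y)⁻¹

lemma transpose_sampleResolvent (τ : ℝ) (y : κ → EuclideanSpace ℝ m) (z : ℂ) :
    (sampleResolvent τ y z)ᵀ = sampleResolvent τ y z := by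
  rw [sampleResolvent, transpose_nonsing_inv, transpose_sub, transpose_smul, transpose_one,
    transpose_sampleCov]

/-- By Cramer's formula, as the determinant never vanishes. Needed for measurability in the sample.
-/
lemma continuous_sampleResolvent {τ : ℝ} (hτ : 0 ≤ τ) {z : ℂ} (hz : z.im ≠ 0) :
    Continuous fun y : κ → EuclideanSpace ℝ m => sampleResolvent τ y z := by
  have hc : Continuous fun y : κ → EuclideanSpace ℝ m =>
      z • (1 : Matrix m m ℂ) - sampleCov τ y := continuous_const.sub (continuous_sampleCov τ)
  simp only [sampleResolvent, inv_def, Ring.inverse_eq_inv']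
  refine Continuous.smul (Continuous.inv₀ hc.matrix_det fun y => ?_) hc.matrix_adjugate
  exact ((isUnit_iff_isUnit_det _).1 (isUnit_smul_one_sub (posSemidef_sampleCov hτ y) hz)).ne_zero

/-- The deviation of the normalized quadratic form of a vector in the resolvent of a sample from
the corresponding trace. -/
noncomputable def quadDeviation (S : Matrix m m ℝ) (τ : ℝ) (z : ℂ) (x : EuclideanSpace ℝ m)
    (y : κ → EuclideanSpace ℝ m) : ℂ :=
  (τ : ℂ) * (cvec x ⬝ᵥ (sampleResolvent τ y z *ᵥ cvec x)) -
    (τ : ℂ) * (sampleResolvent τ y z * S.map (fun r : ℝ => (r : ℂ))).trace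

lemma continuous_quadDeviation (S : Matrix m m ℝ) {τ : ℝ} (hτ : 0 ≤ τ) {z : ℂ} (hz : z.im ≠ 0) :
    Continuous fun p : EuclideanSpace ℝ m × (κ → EuclideanSpace ℝ m) =>
      quadDeviation S τ z p.1 p.2 := by
  have h1 : Continuous fun p : EuclideanSpace ℝ m × (κ → EuclideanSpace ℝ m) =>
    sampleResolvent τ p.2 z := (continuous_sampleResolvent hτ hz).comp continuous_snd
  have h2 : Continuous fun p : EuclideanSpace ℝ m × (κ → EuclideanSpace ℝ m) => cvec p.1 :=
    continuous_cvec.comp continuous_fst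
  exact (continuous_const.mul (h2.dotProduct (h1.matrix_mulVec h2))).sub
    (continuous_const.mul (h1.matrix_mul continuous_const).matrix_trace)

end SampleCovariance

end LedoitPeche

namespace LedoitPeche

open scoped Matrix.Norms.L2Operator ComplexOrder ENNReal MatrixOrder
open Matrix WithLp

/-! ### Complex quadratic forms with general covariance -/

section GaussianComplexForm

lemma enorm_sq_eq_re_add_im (w : ℂ) : ‖w‖ₑ ^ 2 = ‖w.re‖ₑ ^ 2 + ‖w.im‖ₑ ^ 2 := by
  simp only [← ofReal_norm]
  rw [← ENNReal.ofReal_pow (norm_nonneg _), ← ENNReal.ofReal_pow (norm_nonneg _),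
    ← ENNReal.ofReal_pow (norm_nonneg _), ← ENNReal.ofReal_add (by positivity) (by positivity),
    Complex.sq_norm, Complex.normSq_apply]
  simp [pow_two]

variable {m : Type*}

variable [Fintype m]

lemma continuous_quadForm_sub {N : Matrix m m ℂ} (c : ℂ) :
    Continuous fun x : EuclideanSpace ℝ m => cvec x ⬝ᵥ (N *ᵥ cvec x) - c := by
  unfold cvec dotProduct mulVec dotProduct; fun_prop

variable [DecidableEq m]

/-- A resolvent of a real symmetric matrix is symmetric, not Hermitian; its real and imaginary parts
are then real symmetric, and adding their two bounds gives the factor 2. -/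
lemma lintegral_complex_quadForm_sub_trace_le {N : Matrix m m ℂ} (hN : Nᵀ = N) :
    ∫⁻ x, ‖cvec x ⬝ᵥ (N *ᵥ cvec x) - N.trace‖ₑ ^ 2 ∂(stdGaussian (EuclideanSpace ℝ m)) ≤
      ENNReal.ofReal (2 * Var[fun x => x ^ 2; gaussianReal 0 1] * Fintype.card m * ‖N‖ ^ 2) := by
  have hre : (N.map Complex.re).IsHermitian := by
    rw [IsHermitian, conjTranspose_eq_transpose_of_trivial, ← transpose_map, hN]
  have him : (N.map Complex.im).IsHermitian := by
    rw [IsHermitian, conjTranspose_eq_transpose_of_trivial, ← transpose_map, hN]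
  have e1 (x : EuclideanSpace ℝ m) : (cvec x ⬝ᵥ (N *ᵥ cvec x) - N.trace).re =
      ofLp x ⬝ᵥ (N.map Complex.re *ᵥ ofLp x) - (N.map Complex.re).trace := by
    simp [cvec, dotProduct, mulVec, trace]
  have e2 (x : EuclideanSpace ℝ m) : (cvec x ⬝ᵥ (N *ᵥ cvec x) - N.trace).im =
      ofLp x ⬝ᵥ (N.map Complex.im *ᵥ ofLp x) - (N.map Complex.im).trace := by
    simp [cvec, dotProduct, mulVec, trace]
  simp only [enorm_sq_eq_re_add_im, e1, e2]
  rw [lintegral_add_left (by unfold dotProduct mulVec dotProduct; fun_prop)]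
  refine (add_le_add (lintegral_quadForm_sub_trace_le hre)
    (lintegral_quadForm_sub_trace_le him)).trans ?_
  have hc := variance_nonneg (fun x : ℝ => x ^ 2) (gaussianReal 0 1)
  rw [← ENNReal.ofReal_add (by positivity) (by positivity)]
  refine ENNReal.ofReal_le_ofReal ?_
  have h1 := pow_le_pow_left₀ (norm_nonneg _) (l2_opNorm_map_re_le N) 2
  have h2 := pow_le_pow_left₀ (norm_nonneg _) (l2_opNorm_map_im_le N) 2
  have h3 : 0 ≤ Var[fun x => x ^ 2; gaussianReal 0 1] * Fintype.card m := by positivity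
  nlinarith [mul_le_mul_of_nonneg_left h1 h3, mul_le_mul_of_nonneg_left h2 h3]

/-- The norm bound is the C*-identity for the real square root. -/
lemma map_sqrt_mul_map_sqrt {S : Matrix m m ℝ} (hS : S.PosSemidef) :
    ((CFC.sqrt S).map (fun r : ℝ => (r : ℂ)))ᴴ * (CFC.sqrt S).map (fun r : ℝ => (r : ℂ)) =
      S.map (fun r : ℝ => (r : ℂ)) ∧
    ((CFC.sqrt S).map (fun r : ℝ => (r : ℂ)))ᵀ = (CFC.sqrt S).map (fun r : ℝ => (r : ℂ)) ∧
    ‖(CFC.sqrt S).map (fun r : ℝ => (r : ℂ))‖ ^ 2 ≤ ‖S‖ := by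
  have h1 : CFC.sqrt S * CFC.sqrt S = S := CFC.sqrt_mul_sqrt_self _ hS.nonneg
  have h2 : (CFC.sqrt S)ᴴ = CFC.sqrt S := (CFC.sqrt_nonneg S).isSelfAdjoint
  have h3 : (CFC.sqrt S)ᵀ = CFC.sqrt S := by
    rwa [conjTranspose_eq_transpose_of_trivial] at h2
  have h4 : ((CFC.sqrt S).map (fun r : ℝ => (r : ℂ)))ᴴ =
      (CFC.sqrt S).map (fun r : ℝ => (r : ℂ)) := by
    ext i j
    simpa using congrFun (congrFun h3 i) j
  refine ⟨?_, ?_, ?_⟩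
  · rw [h4]
    conv_rhs => rw [← h1]
    exact (Matrix.map_mul (f := Complex.ofRealHom)).symm
  · rw [← transpose_map, h3]
  · calc _ ≤ ‖CFC.sqrt S‖ ^ 2 :=
          pow_le_pow_left₀ (norm_nonneg _) (l2_opNorm_map_ofReal_le _) 2
      _ = ‖(CFC.sqrt S)ᴴ * CFC.sqrt S‖ := by rw [l2_opNorm_conjTranspose_mul_self, pow_two]
      _ = ‖S‖ := by rw [h2, h1]

/-- The variance of a complex quadratic form in a centered Gaussian vector. -/
lemma lintegral_multivariateGaussian_quadForm_le {S : Matrix m m ℝ} (hS : S.PosSemidef)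
    {H : Matrix m m ℂ} (hH : Hᵀ = H) :
    ∫⁻ x, ‖cvec x ⬝ᵥ (H *ᵥ cvec x) - (H * S.map (fun r : ℝ => (r : ℂ))).trace‖ₑ ^ 2
        ∂(multivariateGaussian 0 S) ≤
      ENNReal.ofReal (2 * Var[fun x => x ^ 2; gaussianReal 0 1] * Fintype.card m *
        (‖H‖ * ‖S‖) ^ 2) := by
  obtain ⟨h1, h2, h3⟩ := map_sqrt_mul_map_sqrt hS
  have hvec (x : EuclideanSpace ℝ m) :
      cvec (0 + toEuclideanCLM (𝕜 := ℝ) (CFC.sqrt S) x) =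
        (CFC.sqrt S).map (fun r : ℝ => (r : ℂ)) *ᵥ cvec x := by
    ext i; simp [cvec, mulVec, dotProduct]
  rw [multivariateGaussian, lintegral_map ((continuous_quadForm_sub _).measurable.enorm.pow_const 2)
    (by fun_prop)]
  simp only [hvec]
  set B := (CFC.sqrt S).map (fun r : ℝ => (r : ℂ)) with hB
  have hBH : Bᴴ = Bᵀ := by
    rw [hB]; ext i j; simp
  have hform (x : EuclideanSpace ℝ m) : B *ᵥ cvec x ⬝ᵥ (H *ᵥ (B *ᵥ cvec x)) =
      cvec x ⬝ᵥ ((Bᵀ * H * B) *ᵥ cvec x) := by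
    rw [← mulVec_mulVec, ← mulVec_mulVec, dotProduct_mulVec (cvec x), vecMul_transpose]
  have htr : (H * S.map (fun r : ℝ => (r : ℂ))).trace = (Bᵀ * H * B).trace := by
    rw [← h1, hBH, h2, ← Matrix.mul_assoc, trace_mul_comm, ← Matrix.mul_assoc]
  simp only [hform, htr]
  refine (lintegral_complex_quadForm_sub_trace_le ?_).trans (ENNReal.ofReal_le_ofReal ?_)
  · rw [transpose_mul, transpose_mul, transpose_transpose, hH, Matrix.mul_assoc]
  · have hc := variance_nonneg (fun x : ℝ => x ^ 2) (gaussianReal 0 1)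
    refine mul_le_mul_of_nonneg_left (pow_le_pow_left₀ (norm_nonneg _) ?_ 2) (by positivity)
    rw [h2]
    calc ‖B * H * B‖ ≤ ‖B‖ * ‖H‖ * ‖B‖ := norm_mul₃_le
      _ = ‖H‖ * ‖B‖ ^ 2 := by ring
      _ ≤ ‖H‖ * ‖S‖ := mul_le_mul_of_nonneg_left h3 (norm_nonneg _)

end GaussianComplexForm

/-! ### Integrating out an independent variable -/

section Independence

variable {Ω α β : Type*} [MeasurableSpace Ω] [MeasurableSpace α] [MeasurableSpace β]
  {P : Measure Ω} [IsProbabilityMeasure P]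

/-- Tonelli for the product law: a bound uniform in the frozen value of `Y` survives averaging over
`Y`. This replaces conditioning on the other samples. -/
lemma lintegral_comp_prodMk_le_of_indepFun {μ : Measure α} [SFinite μ] {X : Ω → α} {Y : Ω → β}
    (hX : HasLaw X μ P) (hY : AEMeasurable Y P) (hXY : IndepFun X Y P)
    {F : α × β → ℝ≥0∞} (hF : Measurable F) {c : ℝ≥0∞} (hc : ∀ y, ∫⁻ x, F (x, y) ∂μ ≤ c) :
    ∫⁻ ω, F (X ω, Y ω) ∂P ≤ c := by
  have hpair : AEMeasurable (fun ω => (X ω, Y ω)) P := hX.aemeasurable.prodMk hY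
  have : IsProbabilityMeasure (P.map Y) := Measure.isProbabilityMeasure_map hY
  have hlaw := (indepFun_iff_map_prod_eq_prod_map_map hX.aemeasurable hY).1 hXY
  rw [hX.map_eq] at hlaw
  rw [← lintegral_map' hF.aemeasurable hpair, hlaw, lintegral_prod_symm _ hF.aemeasurable]
  refine (lintegral_mono hc).trans ?_
  simp

end Independence

section SampleDeviation

variable {m : Type*} [Fintype m] [DecidableEq m] {κ : Type*} [Fintype κ]

lemma norm_sampleResolvent_le {τ : ℝ} (hτ : 0 ≤ τ) (y : κ → EuclideanSpace ℝ m) {z : ℂ}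
    (hz : z.im ≠ 0) : ‖sampleResolvent τ y z‖ ≤ |z.im|⁻¹ :=
  norm_resolvent_le (posSemidef_sampleCov hτ y) hz

lemma lintegral_quadDeviation_le {S : Matrix m m ℝ} (hS : S.PosSemidef) {τ : ℝ} (hτ : 0 ≤ τ)
    {z : ℂ} (hz : z.im ≠ 0) (y : κ → EuclideanSpace ℝ m) :
    ∫⁻ x, ‖quadDeviation S τ z x y‖ₑ ^ 2 ∂(multivariateGaussian 0 S) ≤
      ENNReal.ofReal (τ ^ 2 * (2 * Var[fun x => x ^ 2; gaussianReal 0 1] * Fintype.card m *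
        (|z.im|⁻¹ * ‖S‖) ^ 2)) := by
  simp only [quadDeviation, ← mul_sub, enorm_mul, mul_pow]
  rw [lintegral_const_mul' _ _ (by simp), ENNReal.ofReal_mul (by positivity)]
  gcongr
  · rw [← ofReal_norm, Complex.norm_real, Real.norm_of_nonneg hτ, ENNReal.ofReal_pow hτ]
  · rw [← mul_pow]
    refine (lintegral_multivariateGaussian_quadForm_le hS (transpose_sampleResolvent τ y z)).trans
      (ENNReal.ofReal_le_ofReal ?_)
    have hc := variance_nonneg (fun x : ℝ => x ^ 2) (gaussianReal 0 1)
    have := norm_sampleResolvent_le hτ y hz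
    gcongr

end SampleDeviation

end LedoitPeche

namespace LedoitPeche

open scoped Matrix.Norms.L2Operator ComplexOrder ENNReal MatrixOrder
open Matrix WithLp

/-! ### The leave-one-out identity -/

section LeaveOneOut

variable {n T : ℕ}

lemma sampleCov_eq_leaveOneOut_add (τ : ℝ) (x : Fin T → EuclideanSpace ℝ (Fin n)) (t : Fin T) :
    sampleCov τ x = sampleCov τ (fun s : ↥(Finset.univ.erase t) => x s) +
      (τ : ℂ) • vecMulVec (cvec (x t)) (cvec (x t)) := by
  unfold sampleCov
  rw [Finset.sum_coe_sort (Finset.univ.erase t)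
    (fun s => (τ : ℂ) • vecMulVec (cvec (x s)) (cvec (x s))), Finset.sum_erase_add _ _ (by simp)]

lemma map_empCov (x : Fin T → EuclideanSpace ℝ (Fin n)) :
    (empCov x).map (fun r : ℝ => (r : ℂ)) = sampleCov (1 / (T : ℝ)) x := by
  ext i j
  simp [empCov, dataMatrix, Matrix.mul_apply, sampleCov, vecMulVec_apply, Finset.mul_sum, cvec,
    Matrix.sum_apply]

lemma shifted_eq (x : Fin T → EuclideanSpace ℝ (Fin n)) (z : ℂ) :
    shifted x z = z • (1 : Matrix (Fin n) (Fin n) ℂ) - sampleCov (1 / (T : ℝ)) x := by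
  rw [shifted, map_empCov]

lemma resolventMatrix_eq (x : Fin T → EuclideanSpace ℝ (Fin n)) (z : ℂ) :
    resolventMatrix x z = sampleResolvent (1 / (T : ℝ)) x z := by
  rw [resolventMatrix, shifted_eq, sampleResolvent]

/-- The normalized quadratic form of the vector `x t` in the resolvent of the other vectors. -/
noncomputable def looForm (x : Fin T → EuclideanSpace ℝ (Fin n)) (z : ℂ) (t : Fin T) : ℂ :=
  ((1 / (T : ℝ) : ℝ) : ℂ) * (cvec (x t) ⬝ᵥ (sampleResolvent (1 / (T : ℝ))
    (fun s : ↥(Finset.univ.erase t) => x s) z *ᵥ cvec (x t)))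

lemma im_mul_looForm (x : Fin T → EuclideanSpace ℝ (Fin n)) {z : ℂ} (hz : z.im ≠ 0) (t : Fin T) :
    (z * looForm x z t).im * z.im ≤ 0 :=
  im_mul_dotProduct_resolvent (posSemidef_sampleCov (by positivity) _) (star_cvec _)
    (by positivity) hz

lemma denom_eq (hT : 0 < T) (x : Fin T → EuclideanSpace ℝ (Fin n)) {z : ℂ} (hz : z.im ≠ 0) :
    denom x z = 1 / (T : ℂ) * ∑ t, (1 - looForm x z t)⁻¹ := by
  have hT' : (T : ℂ) ≠ 0 := by exact_mod_cast hT.ne'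
  have hform (t : Fin T) : (1 - looForm x z t)⁻¹ = 1 + ((1 / (T : ℝ) : ℝ) : ℂ) *
      (cvec (x t) ⬝ᵥ (sampleResolvent (1 / (T : ℝ)) x z *ᵥ cvec (x t))) := by
    have h := rankOne_dotProduct_resolvent (posSemidef_sampleCov (τ := 1 / (T : ℝ)) (by positivity)
      (fun s : ↥(Finset.univ.erase t) => x s)) (star_cvec (x t))
      (τ := 1 / (T : ℝ)) (by positivity) hz
    rw [← sampleCov_eq_leaveOneOut_add] at h
    exact h.symm
  have htr : (sampleCov (1 / (T : ℝ)) x * sampleResolvent (1 / (T : ℝ)) x z).trace =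
      ∑ t, ((1 / (T : ℝ) : ℝ) : ℂ) *
        (cvec (x t) ⬝ᵥ (sampleResolvent (1 / (T : ℝ)) x z *ᵥ cvec (x t))) := by
    conv_lhs => rw [sampleCov]
    rw [Finset.sum_mul, trace_sum]
    refine Finset.sum_congr rfl fun t _ => ?_
    rw [smul_mul, trace_smul, vecMulVec_mul, trace_vecMulVec, dotProduct_comm, ← dotProduct_mulVec,
      smul_eq_mul]
  -- The trace of `(z - E)(z - E)⁻¹ = 1`; the term `n` cancels `q` in the denominator.
  have hz' : z * (sampleResolvent (1 / (T : ℝ)) x z).trace =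
      n + (sampleCov (1 / (T : ℝ)) x * sampleResolvent (1 / (T : ℝ)) x z).trace := by
    have h := congrArg trace (smul_one_sub_mul_inv
      (posSemidef_sampleCov (τ := 1 / (T : ℝ)) (by positivity) x) hz)
    rw [sub_mul, trace_sub, smul_mul, Matrix.one_mul, trace_smul, trace_one, smul_eq_mul,
      Fintype.card_fin] at h
    rw [← h, sampleResolvent]
    ring
  rw [denom, G, resolventMatrix_eq, mul_left_comm, hz', htr]
  simp only [hform, Finset.sum_add_distrib, Finset.sum_const, Finset.card_univ, Fintype.card_fin,
    nsmul_eq_mul, mul_one]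
  field_simp
  ring

/-- After division by `z`, all terms of the leave-one-out sum have imaginary part strictly of the
sign opposite to `Im z`, so they cannot cancel. -/
lemma denom_ne_zero (x : Fin T → EuclideanSpace ℝ (Fin n)) {z : ℂ} (hz : z.im ≠ 0) :
    denom x z ≠ 0 := by
  -- For `T = 0` division by zero makes the denominator equal to 1.
  rcases Nat.eq_zero_or_pos T with rfl | hT
  · simp [denom, G]
  have hz0 : z ≠ 0 := fun h => hz (by simp [h])
  have hterm (t : Fin T) : (z⁻¹ * (1 - looForm x z t)⁻¹).im * z.im < 0 := by
    have h := im_mul_looForm x hz t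
    have hne : z * (1 - looForm x z t) ≠ 0 := mul_ne_zero hz0 (one_sub_ne_zero_of_im hz h)
    rw [← mul_inv, Complex.inv_im, div_mul_eq_mul_div]
    refine div_neg_of_neg_of_pos ?_ (Complex.normSq_pos.2 hne)
    rw [mul_sub, mul_one, Complex.sub_im]
    have := mul_self_pos.2 hz
    nlinarith
  intro h0
  have h1 : ∑ t, (z⁻¹ * (1 - looForm x z t)⁻¹).im * z.im < 0 := by
    refine Finset.sum_neg (fun t _ => hterm t) ?_
    exact ⟨⟨0, hT⟩, Finset.mem_univ _⟩
  rw [denom_eq hT x hz] at h0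
  have h2 : ∑ t, (1 - looForm x z t)⁻¹ = 0 := by
    have hT' : (1 / (T : ℂ)) ≠ 0 := one_div_ne_zero (by exact_mod_cast hT.ne')
    exact (mul_eq_zero.1 h0).resolve_left hT'
  rw [← Finset.sum_mul, ← Complex.im_sum, ← Finset.mul_sum, h2] at h1
  simp at h1

end LeaveOneOut

/-! ### Deterministic stability estimates -/

section DeterministicBound

variable {n T : ℕ}

lemma opNorm_eq (S : Matrix (Fin n) (Fin n) ℝ) : opNorm S = ‖S‖ := rfl

lemma L_eq (S : Matrix (Fin n) (Fin n) ℝ) (x : Fin T → EuclideanSpace ℝ (Fin n)) (z : ℂ) :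
    L S x z = ((1 / (T : ℝ) : ℝ) : ℂ) *
      (sampleResolvent (1 / (T : ℝ)) x z * S.map (fun r : ℝ => (r : ℂ))).trace := by
  rw [L, resolventMatrix_eq]; simp

lemma im_mul_L {S : Matrix (Fin n) (Fin n) ℝ} (hS : S.PosSemidef)
    (x : Fin T → EuclideanSpace ℝ (Fin n)) {z : ℂ} (hz : z.im ≠ 0) :
    (z * L S x z).im * z.im ≤ 0 := by
  have h := im_mul_trace_resolvent_mul
    (posSemidef_sampleCov (τ := 1 / (T : ℝ)) (by positivity) x)
    ((CFC.sqrt S).map (fun r : ℝ => (r : ℂ))) hz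
  rw [(map_sqrt_mul_map_sqrt hS).1] at h
  rw [L_eq, mul_left_comm, Complex.im_ofReal_mul, mul_assoc]
  exact mul_nonpos_of_nonneg_of_nonpos (by positivity) h

lemma norm_one_sub_L_le (S : Matrix (Fin n) (Fin n) ℝ)
    (x : Fin T → EuclideanSpace ℝ (Fin n)) {z : ℂ} (hz : z.im ≠ 0) :
    ‖1 - L S x z‖ ≤ 1 + (n : ℝ) / T * (opNorm S / |z.im|) := by
  refine (norm_sub_le _ _).trans ?_
  rw [norm_one, L_eq, norm_mul, Complex.norm_real, Real.norm_of_nonneg (by positivity)]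
  have h1 := norm_trace_le (sampleResolvent (1 / (T : ℝ)) x z * S.map (fun r : ℝ => (r : ℂ)))
  have h2 : ‖sampleResolvent (1 / (T : ℝ)) x z * S.map (fun r : ℝ => (r : ℂ))‖ ≤
      |z.im|⁻¹ * ‖S‖ := (norm_mul_le _ _).trans
    (mul_le_mul (norm_sampleResolvent_le (by positivity) x hz) (l2_opNorm_map_ofReal_le S)
      (norm_nonneg _) (by positivity))
  rw [Fintype.card_fin] at h1
  have h3 := h1.trans (mul_le_mul_of_nonneg_left h2 (Nat.cast_nonneg n))
  have h4 := mul_le_mul_of_nonneg_left h3 (by positivity : 0 ≤ 1 / (T : ℝ))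
  rw [opNorm_eq]
  calc _ ≤ 1 + 1 / (T : ℝ) * (n * (|z.im|⁻¹ * ‖S‖)) := by linarith
    _ = _ := by ring

lemma norm_inv_one_sub_le {z u : ℂ} (hz : z.im ≠ 0) (h : (z * u).im * z.im ≤ 0) :
    ‖(1 - u)⁻¹‖ ≤ ‖z‖ / |z.im| := by
  have hpos : 0 < ‖1 - u‖ := norm_pos_iff.2 (one_sub_ne_zero_of_im hz h)
  have hz' : 0 < |z.im| := abs_pos.2 hz
  rw [norm_inv, inv_eq_one_div, div_le_div_iff₀ hpos hz', one_mul]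
  exact abs_im_le_norm_mul_norm_one_sub h

lemma norm_inv_one_sub_sub_le {z u v : ℂ} (hz : z.im ≠ 0) (hu : (z * u).im * z.im ≤ 0)
    (hv : (z * v).im * z.im ≤ 0) :
    ‖(1 - u)⁻¹ - (1 - v)⁻¹‖ ≤ (‖z‖ / |z.im|) ^ 2 * ‖u - v‖ := by
  have hu' := one_sub_ne_zero_of_im hz hu
  have hv' := one_sub_ne_zero_of_im hz hv
  have e : (1 - u)⁻¹ - (1 - v)⁻¹ = (1 - u)⁻¹ * (1 - v)⁻¹ * (u - v) := by
    field_simp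
    ring
  rw [e, norm_mul, norm_mul, pow_two]
  gcongr
  · exact norm_inv_one_sub_le hz hu
  · exact norm_inv_one_sub_le hz hv

/-- The deviation of `looForm` from its conditional mean. -/
noncomputable def looDeviation (S : Matrix (Fin n) (Fin n) ℝ) (x : Fin T → EuclideanSpace ℝ (Fin n)) (z : ℂ)
    (t : Fin T) : ℂ :=
  quadDeviation S (1 / (T : ℝ)) z (x t) (fun s : ↥(Finset.univ.erase t) => x s)

lemma norm_looForm_sub_L_le (S : Matrix (Fin n) (Fin n) ℝ) (x : Fin T → EuclideanSpace ℝ (Fin n))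
    {z : ℂ} (hz : z.im ≠ 0) (t : Fin T) :
    ‖looForm x z t - L S x z‖ ≤ ‖looDeviation S x z t‖ + 1 / (T : ℝ) * (opNorm S / |z.im|) := by
  have h := norm_trace_resolvent_mul_sub_le
    (posSemidef_sampleCov (τ := 1 / (T : ℝ)) (by positivity)
      (fun s : ↥(Finset.univ.erase t) => x s)) (transpose_sampleCov _ _)
    (S.map (fun r : ℝ => (r : ℂ))) (star_cvec (x t)) (τ := 1 / (T : ℝ)) (by positivity) hz
  rw [← sampleCov_eq_leaveOneOut_add] at h
  have h' := h.trans (div_le_div_of_nonneg_right (l2_opNorm_map_ofReal_le S) (abs_nonneg z.im))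
  rw [L_eq, opNorm_eq]
  set y := fun s : ↥(Finset.univ.erase t) => x s
  have e : looForm x z t - ((1 / (T : ℝ) : ℝ) : ℂ) *
        (sampleResolvent (1 / (T : ℝ)) x z * S.map (fun r : ℝ => (r : ℂ))).trace =
      looDeviation S x z t - ((1 / (T : ℝ) : ℝ) : ℂ) *
        ((sampleResolvent (1 / (T : ℝ)) x z * S.map (fun r : ℝ => (r : ℂ))).trace -
          (sampleResolvent (1 / (T : ℝ)) y z * S.map (fun r : ℝ => (r : ℂ))).trace) := by
    unfold looForm looDeviation quadDeviation
    ring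
  rw [e]
  refine (norm_sub_le _ _).trans ?_
  gcongr
  rw [norm_mul, Complex.norm_real, Real.norm_of_nonneg (by positivity)]
  exact mul_le_mul_of_nonneg_left h' (by positivity)

lemma norm_denom_sub_le (hT : 0 < T) {S : Matrix (Fin n) (Fin n) ℝ} (hS : S.PosSemidef)
    (x : Fin T → EuclideanSpace ℝ (Fin n)) {z : ℂ} (hz : z.im ≠ 0) :
    ‖denom x z - (1 - L S x z)⁻¹‖ ≤ (‖z‖ / |z.im|) ^ 2 *
      (1 / (T : ℝ) * ∑ t, ‖looDeviation S x z t‖ + 1 / (T : ℝ) * (opNorm S / |z.im|)) := by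
  have hTR : (0 : ℝ) < T := by exact_mod_cast hT
  have hTC : (T : ℂ) ≠ 0 := by exact_mod_cast hT.ne'
  have e : denom x z - (1 - L S x z)⁻¹ =
      ((1 / (T : ℝ) : ℝ) : ℂ) * ∑ t, ((1 - looForm x z t)⁻¹ - (1 - L S x z)⁻¹) := by
    rw [denom_eq hT x hz, Finset.sum_sub_distrib]
    simp [mul_sub, hTC]
  have hsum : ‖∑ t, ((1 - looForm x z t)⁻¹ - (1 - L S x z)⁻¹)‖ ≤
      ∑ t, (‖z‖ / |z.im|) ^ 2 *
        (‖looDeviation S x z t‖ + 1 / (T : ℝ) * (opNorm S / |z.im|)) := by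
    refine (norm_sum_le _ _).trans (Finset.sum_le_sum fun t _ => ?_)
    exact (norm_inv_one_sub_sub_le hz (im_mul_looForm x hz t) (im_mul_L hS x hz)).trans
      (mul_le_mul_of_nonneg_left (norm_looForm_sub_L_le S x hz t) (by positivity))
  rw [e, norm_mul, Complex.norm_real, Real.norm_of_nonneg (by positivity)]
  refine (mul_le_mul_of_nonneg_left hsum (by positivity)).trans (le_of_eq ?_)
  rw [← Finset.mul_sum, Finset.sum_add_distrib]
  simp only [Finset.sum_const, Finset.card_univ, Fintype.card_fin, nsmul_eq_mul]
  field_simp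

/-- Here `d(1 - u)` is within `Cη ≤ 1/2` of 1, which forces `|d| ≥ 1/(2C)`; then divide `1 - d(1 -
u)` by `d`. -/
lemma norm_sub_one_sub_one_div_le {d u : ℂ} {C η : ℝ} (hC : 0 < C) (hu : 1 - u ≠ 0)
    (huC : ‖1 - u‖ ≤ C) (hd : ‖d - (1 - u)⁻¹‖ ≤ η) (hη : C * η ≤ 1 / 2) :
    ‖u - (1 - 1 / d)‖ ≤ 2 * C ^ 2 * η := by
  have hη0 : 0 ≤ η := (norm_nonneg _).trans hd
  have h1 : ‖1 - d * (1 - u)‖ ≤ C * η := by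
    have e : 1 - d * (1 - u) = -((1 - u) * (d - (1 - u)⁻¹)) := by
      field_simp
      ring
    rw [e, norm_neg, norm_mul]
    exact mul_le_mul huC hd (norm_nonneg _) hC.le
  have h2 : 1 / 2 ≤ ‖d‖ * C := by
    have h3 : (1 : ℝ) ≤ ‖1 - d * (1 - u)‖ + ‖d * (1 - u)‖ := by
      have := norm_add_le (1 - d * (1 - u)) (d * (1 - u))
      simpa using this
    rw [norm_mul] at h3
    nlinarith [mul_le_mul_of_nonneg_left huC (norm_nonneg d)]
  have hd0 : d ≠ 0 := by
    rintro rfl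
    rw [norm_zero, zero_mul] at h2
    norm_num at h2
  have hdpos : 0 < ‖d‖ := norm_pos_iff.2 hd0
  have e : u - (1 - 1 / d) = (1 - d * (1 - u)) / d := by
    field_simp
    ring
  rw [e, norm_div, div_le_iff₀ hdpos]
  nlinarith [mul_nonneg hC.le hη0]

end DeterministicBound

/-! ### Probability that the quadratic forms deviate -/

section Probability

variable {n T : ℕ} {Ω : Type*} [MeasurableSpace Ω] {P : Measure Ω}

lemma indepFun_leaveOneOut {X : Fin T → Ω → EuclideanSpace ℝ (Fin n)}
    (hX : ∀ t, AEMeasurable (X t) P) (hindep : iIndepFun X P) (t : Fin T) :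
    IndepFun (X t) (fun ω (s : ↥(Finset.univ.erase t)) => X s ω) P := by
  have h := hindep.indepFun_finset₀ {t} (Finset.univ.erase t) (by simp) hX
  exact h.comp (φ := fun y : ↥({t} : Finset (Fin T)) → EuclideanSpace ℝ (Fin n) =>
    y ⟨t, Finset.mem_singleton_self t⟩) (ψ := id) (measurable_pi_apply _) measurable_id

variable [IsProbabilityMeasure P]

lemma lintegral_looDeviation_le {S : Matrix (Fin n) (Fin n) ℝ} (hS : S.PosSemidef)
    {X : Fin T → Ω → EuclideanSpace ℝ (Fin n)}
    (hlaw : ∀ t, HasLaw (X t) (multivariateGaussian 0 S) P) (hindep : iIndepFun X P)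
    {z : ℂ} (hz : z.im ≠ 0) (t : Fin T) :
    AEMeasurable (fun ω => ‖looDeviation S (fun t => X t ω) z t‖ₑ ^ 2) P ∧
    ∫⁻ ω, ‖looDeviation S (fun t => X t ω) z t‖ₑ ^ 2 ∂P ≤
      ENNReal.ofReal ((1 / (T : ℝ)) ^ 2 * (2 * Var[fun x => x ^ 2; gaussianReal 0 1] * n *
        (|z.im|⁻¹ * opNorm S) ^ 2)) := by
  have hτ : (0 : ℝ) ≤ 1 / (T : ℝ) := by positivity
  have hX (t : Fin T) : AEMeasurable (X t) P := (hlaw t).aemeasurable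
  have hY : AEMeasurable (fun ω (s : ↥(Finset.univ.erase t)) => X s ω) P :=
    aemeasurable_pi_lambda _ fun s => hX s
  have hF : Measurable fun p : EuclideanSpace ℝ (Fin n) ×
      (↥(Finset.univ.erase t) → EuclideanSpace ℝ (Fin n)) =>
      ‖quadDeviation S (1 / (T : ℝ)) z p.1 p.2‖ₑ ^ 2 :=
    (continuous_quadDeviation S hτ hz).measurable.enorm.pow_const 2
  have hpair := hF.comp_aemeasurable ((hX t).prodMk hY)
  simp only [Function.comp_def] at hpair
  simp only [looDeviation]
  refine ⟨hpair, ?_⟩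
  have h := lintegral_comp_prodMk_le_of_indepFun (hlaw t) hY (indepFun_leaveOneOut hX hindep t) hF
    fun y => lintegral_quadDeviation_le hS hτ hz y
  rwa [Fintype.card_fin] at h

/-- Cauchy–Schwarz passes to the sum of squares, then Markov applies. The `T` second moments are
simply added, so dependence between the deviations is harmless. -/
lemma measure_le_sum_looDeviation_le (hT : 0 < T) {S : Matrix (Fin n) (Fin n) ℝ}
    (hS : S.PosSemidef) {X : Fin T → Ω → EuclideanSpace ℝ (Fin n)}
    (hlaw : ∀ t, HasLaw (X t) (multivariateGaussian 0 S) P) (hindep : iIndepFun X P)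
    {z : ℂ} (hz : z.im ≠ 0) {δ : ℝ} (hδ : 0 < δ) :
    P {ω | δ ≤ 1 / (T : ℝ) * ∑ t, ‖looDeviation S (fun t => X t ω) z t‖} ≤
      ENNReal.ofReal (2 * Var[fun x => x ^ 2; gaussianReal 0 1] * (n / T) *
        (opNorm S / |z.im|) ^ 2 / δ ^ 2 / T) := by
  have hTR : (0 : ℝ) < T := by exact_mod_cast hT
  have hV := variance_nonneg (fun x : ℝ => x ^ 2) (gaussianReal 0 1)
  have hsub : {ω | δ ≤ 1 / (T : ℝ) * ∑ t, ‖looDeviation S (fun t => X t ω) z t‖} ⊆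
      {ω | ENNReal.ofReal (δ ^ 2 * T) ≤
        ∑ t, ‖looDeviation S (fun t => X t ω) z t‖ₑ ^ 2} := by
    intro ω hω
    have h1 := sq_sum_le_card_mul_sum_sq (s := Finset.univ)
      (f := fun t => ‖looDeviation S (fun t => X t ω) z t‖)
    rw [Finset.card_univ, Fintype.card_fin] at h1
    have h2 : δ * T ≤ ∑ t, ‖looDeviation S (fun t => X t ω) z t‖ := by
      have : δ ≤ 1 / (T : ℝ) * ∑ t, ‖looDeviation S (fun t => X t ω) z t‖ := hω
      rwa [one_div_mul_eq_div, le_div_iff₀ hTR] at this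
    have h3 : (δ * T) ^ 2 ≤ (∑ t, ‖looDeviation S (fun t => X t ω) z t‖) ^ 2 :=
      pow_le_pow_left₀ (by positivity) h2 2
    have h4 : δ ^ 2 * T ≤ ∑ t, ‖looDeviation S (fun t => X t ω) z t‖ ^ 2 := by
      refine le_of_mul_le_mul_left ?_ hTR
      calc (T : ℝ) * (δ ^ 2 * T) = (δ * T) ^ 2 := by ring
        _ ≤ _ := h3.trans h1
    refine (ENNReal.ofReal_le_ofReal h4).trans (le_of_eq ?_)
    rw [ENNReal.ofReal_sum_of_nonneg fun t _ => by positivity]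
    refine Finset.sum_congr rfl fun t _ => ?_
    rw [ENNReal.ofReal_pow (norm_nonneg _), ofReal_norm]
  have hdev := lintegral_looDeviation_le hS hlaw hindep hz
  refine (measure_mono hsub).trans ?_
  refine (meas_ge_le_lintegral_div (Finset.aemeasurable_fun_sum _ fun t _ => (hdev t).1)
    (by positivity) ENNReal.ofReal_ne_top).trans ?_
  rw [lintegral_finsetSum' _ fun t _ => (hdev t).1]
  refine (ENNReal.div_le_div_right (Finset.sum_le_sum fun t _ => (hdev t).2) _).trans ?_
  rw [Finset.sum_const, Finset.card_univ, Fintype.card_fin, nsmul_eq_mul,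
    ← ENNReal.ofReal_natCast, ← ENNReal.ofReal_mul hTR.le,
    ← ENNReal.ofReal_div_of_pos (by positivity)]
  refine ENNReal.ofReal_le_ofReal (le_of_eq ?_)
  have : |z.im| ≠ 0 := abs_ne_zero.2 hz
  field_simp

end Probability

end LedoitPeche

/-! ### The limit in probability -/

theorem theorem1 {ι : Type*} (l : Filter ι) (n T : ι → ℕ)
    (S : ∀ k, Matrix (Fin (n k)) (Fin (n k)) ℝ) (hS : ∀ k, (S k).PosSemidef)
    {Ω : ι → Type*} [∀ k, MeasurableSpace (Ω k)]
    (P : ∀ k, Measure (Ω k)) [∀ k, IsProbabilityMeasure (P k)]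
    (X : ∀ k, Fin (T k) → Ω k → EuclideanSpace ℝ (Fin (n k)))
    (hlaw : ∀ k t, HasLaw (X k t) (multivariateGaussian 0 (S k)) (P k))
    (hindep : ∀ k, iIndepFun (X k) (P k))
    (hn : Tendsto n l atTop) (hT : Tendsto T l atTop)
    (hq : ∃ C : ℝ, ∀ᶠ k in l, (n k : ℝ) / (T k : ℝ) ≤ C)
    (hop : ∃ C : ℝ, ∀ᶠ k in l, LedoitPeche.opNorm (S k) ≤ C)
    (htr : ∃ C : ℝ, ∀ᶠ k in l, 0 < (S k).trace ∧ (T k : ℝ) / (S k).trace ≤ C)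
    (z : ℂ) (hz : z.im ≠ 0) :
    (∀ k ω, IsUnit (LedoitPeche.shifted (fun t => X k t ω) z) ∧
      LedoitPeche.denom (fun t => X k t ω) z ≠ 0) ∧
    LedoitPeche.TendsToZeroInProbability l P (fun k ω =>
      LedoitPeche.L (S k) (fun t => X k t ω) z -
        (1 - 1 / LedoitPeche.denom (fun t => X k t ω) z)) := by
  refine ⟨fun k ω => ⟨?_, LedoitPeche.denom_ne_zero _ hz⟩, fun ε hε => ?_⟩
  · rw [LedoitPeche.shifted_eq]
    exact LedoitPeche.isUnit_smul_one_sub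
      (LedoitPeche.posSemidef_sampleCov (by positivity) _) hz
  obtain ⟨Cq, hCq⟩ := hq
  obtain ⟨Co, hCo⟩ := hop
  have hz' : 0 < |z.im| := abs_pos.2 hz
  have hz0 : 0 < ‖z‖ := norm_pos_iff.2 fun h => hz (by simp [h])
  set B : ℝ := max Co 0 / |z.im| with hB
  have hB0 : 0 ≤ B := by positivity
  -- Eventual bound for `|1 - L|`; the maxima with 0 make positivity immediate.
  set C : ℝ := 1 + max Cq 0 * B with hC
  have hC0 : 0 < C := by positivity
  set κ : ℝ := (‖z‖ / |z.im|) ^ 2 with hκ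
  have hκ0 : 0 < κ := by positivity
  -- Allowed distance from `1 - q + zG` to `(1 - L)⁻¹`: the first entry permits the inversion, the
  -- second makes the final error at most `ε / 2`.
  set η : ℝ := min (1 / (2 * C)) (ε / (4 * C ^ 2)) with hη
  have hη0 : 0 < η := lt_min (by positivity) (by positivity)
  have hη1 : C * η ≤ 1 / 2 := by
    calc C * η ≤ C * (1 / (2 * C)) := mul_le_mul_of_nonneg_left (min_le_left _ _) hC0.le
      _ = 1 / 2 := by field_simp
  have hη2 : 2 * C ^ 2 * η < ε := by
    calc 2 * C ^ 2 * η ≤ 2 * C ^ 2 * (ε / (4 * C ^ 2)) :=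
          mul_le_mul_of_nonneg_left (min_le_right _ _) (by positivity)
      _ = ε / 2 := by field_simp; norm_num
      _ < ε := half_lt_self hε
  -- The fluctuation and the rank-one error get `δ` each, and `κ(δ + δ) = η`, where `κ` is the
  -- Lipschitz constant of `u ↦ (1 - u)⁻¹`.
  set δ : ℝ := η / (2 * κ) with hδ
  have hδ0 : 0 < δ := by positivity
  have hTR : Tendsto (fun k => (T k : ℝ)) l atTop := tendsto_natCast_atTop_atTop.comp hT
  have hV := variance_nonneg (fun x : ℝ => x ^ 2) (gaussianReal 0 1)
  set V := Var[fun x : ℝ => x ^ 2; gaussianReal 0 1]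
  have hlim : Tendsto (fun k => ENNReal.ofReal (2 * V * max Cq 0 * B ^ 2 / δ ^ 2 / (T k : ℝ))) l
      (𝓝 0) := by
    have := ENNReal.tendsto_ofReal
      (hTR.const_div_atTop (2 * V * max Cq 0 * B ^ 2 / δ ^ 2))
    rwa [ENNReal.ofReal_zero] at this
  have hsmall : ∀ᶠ k in l, B / (T k : ℝ) < δ := (hTR.const_div_atTop B).eventually_lt_const hδ0
  refine tendsto_of_tendsto_of_tendsto_of_le_of_le' tendsto_const_nhds hlim
    (Eventually.of_forall fun _ => zero_le) ?_
  filter_upwards [hCq, hCo, hsmall, hT.eventually_gt_atTop 0] with k hqk hok hsk hTk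
  have hTk' : (0 : ℝ) < T k := by exact_mod_cast hTk
  have hop0 : 0 ≤ LedoitPeche.opNorm (S k) := norm_nonneg _
  have hopB : LedoitPeche.opNorm (S k) / |z.im| ≤ B :=
    div_le_div_of_nonneg_right (hok.trans (le_max_left _ _)) hz'.le
  have hqk' : (n k : ℝ) / T k ≤ max Cq 0 := hqk.trans (le_max_left _ _)
  -- All randomness sits in the averaged deviation: when it is below `δ`, the deterministic
  -- estimates give an error below `ε`.
  have hsub : {ω | ε ≤ ‖LedoitPeche.L (S k) (fun t => X k t ω) z -
        (1 - 1 / LedoitPeche.denom (fun t => X k t ω) z)‖} ⊆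
      {ω | δ ≤ 1 / (T k : ℝ) *
        ∑ t, ‖LedoitPeche.looDeviation (S k) (fun t => X k t ω) z t‖} := by
    intro ω hω
    by_contra hlt
    rw [Set.mem_ofPred_eq, not_le] at hlt
    refine absurd hω (not_le.2 (lt_of_le_of_lt ?_ hη2))
    refine LedoitPeche.norm_sub_one_sub_one_div_le hC0
      (LedoitPeche.one_sub_ne_zero_of_im hz (LedoitPeche.im_mul_L (hS k) _ hz)) ?_ ?_ hη1
    · refine (LedoitPeche.norm_one_sub_L_le (S k) _ hz).trans ?_
      rw [hC]
      gcongr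
    · refine (LedoitPeche.norm_denom_sub_le hTk (hS k) _ hz).trans ?_
      have h1 : 1 / (T k : ℝ) * (LedoitPeche.opNorm (S k) / |z.im|) ≤ δ := by
        refine le_trans ?_ hsk.le
        rw [one_div_mul_eq_div]
        exact div_le_div_of_nonneg_right hopB hTk'.le
      calc _ ≤ κ * (δ + δ) := mul_le_mul_of_nonneg_left (add_le_add hlt.le h1) hκ0.le
        _ = η := by rw [hδ]; field_simp; norm_num
  refine (measure_mono hsub).trans
    ((LedoitPeche.measure_le_sum_looDeviation_le hTk (hS k) (hlaw k) (hindep k) hz hδ0).trans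
      (ENNReal.ofReal_le_ofReal ?_))
  gcongr
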